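/- Let $(\Gamma,V)$ be a right-angled Coxeter system with $V\neq\emptyset$, i.e. $\Gamma$ is a group with a presentation $\langle V\mid (vw)^{m(v,w)}=1\ (v,w\in V)\rangle$, where $m(v,v)=1$ and $m(v,w)=m(w,v)\in\{2,\infty\}$ for $v\ne w$ (there is no relation when $m(v,w)=\infty$). Let $K=K(\Gamma,V)$ be the simplicial complex whose simplices are the nonempty finite subsets of $V$ that generate finite subgroups of $\Gamma$. Let $N$ be the number of vertices of $K$ (that is, $N=|V|$) and $M$ the number of its edges. Let $n\ge 0$, let $W$ be a set of $n+1$ colours, and let $c:V\to W$ be a colouring of the 1-skeleton $K^1$ (the two ends of each edge have different colours) such that for every $v\in V$ the star of $v$ in $K$ (the union of the simplices containing $v$, so $v$ itself belongs to it) contains vertices of all colours. Then there is a torsion-free subgroup $P$ of finite index in $\Gamma\times\mathbb Z^{n+1}$ that, for every choice of an order $(v,v')$ of the two ends of each edge of $K$ and of a vertex $v_w$ with $c(v_w)=w$ for each colour $w\in W$, has a presentation with generating set $V$ (hence with $N$ generators) whose relators are the following words, all of length four: (i) for every edge of $K$ with ends $v,v'$, the commutator $[v,v']$; (ii) for every colour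 $w\in W$ and every $v\neq v_w$ with $c(v)=w$, the word $v^2v_w^{-2}$. The number of relators is $M+N-n-1$. (If $V$ is infinite, this is read as the equality of cardinals: the number of relators plus $n+1$ equals $M+N$.) -/

import Mathlib

/-- A Coxeter system is right-angled if every `m(v, w)` is `1`, `2` or `∞`
(Mathlib encodes `∞` as `0`). -/
def CoxeterMatrix.IsRightAngled {V : Type*} (m : CoxeterMatrix V) : Prop :=
  ∀ v w : V, m v w = 1 ∨ m v w = 2 ∨ m v w = 0

/-- The simplicial complex `K(Γ, V)`: its simplices are the nonempty finite subsets of `V` that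
generate finite subgroups of `Γ`. -/
def CoxeterSystem.complexK {V Γ : Type*} [Group Γ] {m : CoxeterMatrix V}
    (cs : CoxeterSystem m Γ) : AbstractSimplicialComplex V where
  faces := {σ | σ.Nonempty ∧
    (Subgroup.closure (cs.simple '' (σ : Set V)) : Set Γ).Finite}
  isRelLowerSet_faces := by
    intro σ hσ
    refine ⟨hσ.1, fun τ hτ hne => ⟨hne, hσ.2.subset ?_⟩⟩
    exact Subgroup.closure_mono (Set.image_mono (Finset.coe_subset.mpr hτ))
  singleton_mem := by
    intro v
    refine ⟨Finset.singleton_nonempty v, ?_⟩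
    rw [Finset.coe_singleton, Set.image_singleton, ← Subgroup.zpowers_eq_closure]
    have h : IsOfFinOrder (cs.simple v) :=
      isOfFinOrder_iff_pow_eq_one.mpr ⟨2, by norm_num, cs.simple_sq v⟩
    exact h.finite_zpowers

/-- The 1-skeleton of an abstract simplicial complex, as a graph. -/
def AbstractSimplicialComplex.oneSkeleton {V : Type*} [DecidableEq V]
    (K : AbstractSimplicialComplex V) : SimpleGraph V where
  Adj v w := v ≠ w ∧ ({v, w} : Finset V) ∈ K.faces
  symm := ⟨fun v w h => ⟨h.1.symm, by rw [Finset.pair_comm]; exact h.2⟩⟩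
  loopless := ⟨fun _ h => h.1 rfl⟩

/-- The vertices of the (closed) star of `v`: those that lie in a common simplex with `v`. -/
def AbstractSimplicialComplex.starVertices {V : Type*}
    (K : AbstractSimplicialComplex V) (v : V) : Set V :=
  {u | ∃ σ ∈ K.faces, v ∈ σ ∧ u ∈ σ}

/-- A group is torsion-free if only the identity element has finite order. (For noncommutative
groups this is weaker than `IsMulTorsionFree`, which asks for uniqueness of roots.) -/
def GroupTorsionFree (G : Type*) [Group G] : Prop :=
  ∀ g : G, IsOfFinOrder g → g = 1

/-- The relators attached to a graph `X` on `V` with a colouring `c`, given an orientation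
`d` of the edges and, for each colour `w`, a base vertex `b w`:
the commutators `[v, v'] = v v' v⁻¹ v'⁻¹`, one for each edge, and the words `v² (b w)⁻²`, one for each vertex `v`
with colour `w` that is different from `b w`. -/
def colouredRelators {V W : Type*} {X : SimpleGraph V} (c : X.Coloring W)
    (d : X.edgeSet → X.Dart) (b : W → V) : Set (FreeGroup V) :=
  {r | ∃ e : X.edgeSet, r = FreeGroup.of (d e).fst * FreeGroup.of (d e).snd *
    (FreeGroup.of (d e).fst)⁻¹ * (FreeGroup.of (d e).snd)⁻¹} ∪
  {r | ∃ (w : W) (v : V), c v = w ∧ v ≠ b w ∧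
    r = FreeGroup.of v ^ 2 * (FreeGroup.of (b w) ^ 2)⁻¹}

/-! Take for `P` the pairs `(g, z)` such that, for every colour `w`, the parity of the number of
letters of colour `w` in `g` equals the parity of `z w`. This is the kernel of a homomorphism to the
finite group `W → ℤˣ`, where `W` is the set of colours.

Torsion-freeness: a torsion element has `z = 0`, so `g` is torsion with all colour parities even.
Colours are removed one at a time. Generators of one colour never commute with each other, so `Γ`
embeds in a semidirect product with a free normal factor, and an element killed both by the parity
of `w` and by the retraction deleting `w` lies in the free factor
(`eq_one_of_colourSign_of_killColours`).

Presentation: send `v` to `(s_v, e_{c v})`, where `s_v` is the Coxeter generator and `e_w` the basis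
vector. In the presented group all squares of a given colour agree. They are central because every
star meets every colour. Modulo these squares the Coxeter relations hold, while the squares map to
the independent vectors `2 e_w`. This gives injectivity, and parity identifies the image. -/

theorem CoxeterMatrix.IsRightAngled.isLiftable {V G : Type*} [Group G] {m : CoxeterMatrix V}
    (hm : m.IsRightAngled) {f : V → G} (hsq : ∀ v, f v * f v = 1)
    (hcomm : ∀ v w, m v w = 2 → Commute (f v) (f w)) : m.IsLiftable f := by
  intro v w
  rcases hm v w with h | h | h
  · obtain rfl : v = w := by
      by_contra hne
      exact m.off_diagonal v w hne h
    rw [h, pow_one, hsq]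
  · rw [h, (hcomm v w h).mul_pow, pow_two, pow_two, hsq, hsq, one_mul]
  · rw [h, pow_zero]

/-! ### A free group with commuting actions of signs and of conjugation. -/

namespace FreeGroup

/-- The automorphism of the free group on the elements of `G` that sends the generator
attached to `g` to the inverse of the generator attached to `g⁻¹`. -/
def invGenerators (G : Type*) [Group G] : MulAut (FreeGroup G) :=
  MonoidHom.toMulEquiv (FreeGroup.lift fun g : G => (of g⁻¹)⁻¹)
    (FreeGroup.lift fun g : G => (of g⁻¹)⁻¹) (by ext; simp) (by ext; simp)

@[simp]
theorem invGenerators_of {G : Type*} [Group G] (g : G) :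
    invGenerators G (of g) = (of g⁻¹)⁻¹ := by
  simp [invGenerators]

/-- `ℤˣ` acts on the free group on the elements of `G` through `FreeGroup.invGenerators`. -/
def signGenerators (G : Type*) [Group G] : ℤˣ →* MulAut (FreeGroup G) where
  toFun u := if u = 1 then 1 else invGenerators G
  map_one' := by simp
  map_mul' u u' := by
    have h : invGenerators G * invGenerators G = 1 := by
      apply MulEquiv.toMonoidHom_injective
      ext g
      simp
    rcases Int.units_eq_one_or u with rfl | rfl <;> rcases Int.units_eq_one_or u' with rfl | rfl <;>
      simp [h]

/-- The action of `G` on the free group on its elements by conjugation of the generators. -/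
def conjGenerators (G : Type*) [Group G] : G →* MulAut (FreeGroup G) where
  toFun g := freeGroupCongr (MulAut.conj g).toEquiv
  map_one' := by
    apply MulEquiv.toMonoidHom_injective
    ext g
    simp
  map_mul' g g' := by
    apply MulEquiv.toMonoidHom_injective
    ext x
    simp [mul_assoc]

@[simp]
theorem conjGenerators_of {G : Type*} [Group G] (g x : G) :
    conjGenerators G g (of x) = of (g * x * g⁻¹) := by
  simp [conjGenerators]

/-- The combined action of `ℤˣ` and `G` on the free group on the elements of `G`. -/
def signConjGenerators (G : Type*) [Group G] : ℤˣ × G →* MulAut (FreeGroup G) :=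
  MonoidHom.noncommCoprod (signGenerators G) (conjGenerators G) fun u g => by
    rcases Int.units_eq_one_or u with rfl | rfl
    · simp
    · apply MulEquiv.toMonoidHom_injective
      ext x
      simp [signGenerators, mul_assoc]

@[simp]
theorem signConjGenerators_neg_one {G : Type*} [Group G] (x : G) :
    signConjGenerators G (-1, 1) (of x) = (of x⁻¹)⁻¹ := by
  simp [signConjGenerators, signGenerators]

@[simp]
theorem signConjGenerators_one {G : Type*} [Group G] (g x : G) :
    signConjGenerators G (1, g) (of x) = of (g * x * g⁻¹) := by
  simp [signConjGenerators]

/-- Evaluation of words in the elements of `G`, extended to the semidirect product. -/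
def evalSignConj (G : Type*) [Group G] :
    FreeGroup G ⋊[signConjGenerators G] (ℤˣ × G) →* G :=
  SemidirectProduct.lift (FreeGroup.lift id) (MonoidHom.snd ℤˣ G) fun p => by
    obtain ⟨u, g⟩ := p
    ext x
    rcases Int.units_eq_one_or u with rfl | rfl <;>
      simp [signConjGenerators, signGenerators, mul_assoc]

end FreeGroup

/-! ### Colour parities, retractions, and torsion in right-angled Coxeter groups. -/

namespace CoxeterSystem

variable {V Γ W : Type*} [Group Γ] [DecidableEq W] {m : CoxeterMatrix V}

theorem commute_simple (cs : CoxeterSystem m Γ) {v w : V} (h : m v w = 2) :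
    Commute (cs.simple v) (cs.simple w) := by
  have h1 := cs.simple_mul_simple_pow v w
  rw [h, pow_two] at h1
  have h2 := eq_inv_of_mul_eq_one_left h1
  rwa [mul_inv_rev, cs.inv_simple, cs.inv_simple] at h2

/-- The parity of the number of letters of colour `w`. -/
def colourSign (cs : CoxeterSystem m Γ) (hm : m.IsRightAngled) (c : V → W) (w : W) : Γ →* ℤˣ :=
  cs.lift ⟨fun v => if c v = w then -1 else 1, hm.isLiftable
    (fun v => by split_ifs <;> simp) (fun _ _ _ => Commute.all _ _)⟩

@[simp]
theorem colourSign_simple (cs : CoxeterSystem m Γ) (hm : m.IsRightAngled) (c : V → W) (w : W)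
    (v : V) : cs.colourSign hm c w (cs.simple v) = if c v = w then -1 else 1 :=
  cs.lift_apply_simple _ v

/-- The retraction that kills the generators with colours in `S`. -/
def killColours (cs : CoxeterSystem m Γ) (hm : m.IsRightAngled) (c : V → W) (S : Finset W) :
    Γ →* Γ :=
  cs.lift ⟨fun v => if c v ∈ S then 1 else cs.simple v, hm.isLiftable
    (fun v => by split_ifs <;> simp)
    (fun v v' h => by split_ifs <;> simp [cs.commute_simple h])⟩

@[simp]
theorem killColours_simple (cs : CoxeterSystem m Γ) (hm : m.IsRightAngled) (c : V → W)
    (S : Finset W) (v : V) :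
    cs.killColours hm c S (cs.simple v) = if c v ∈ S then 1 else cs.simple v :=
  cs.lift_apply_simple _ v

/-- The map `Φ` below sends letters of colour `w` to free generators twisted by a sign and keeps the
other letters in the quotient factor. Evaluating words is a left inverse, so `Φ` is injective. The
hypotheses on `g` say that `Φ g` lies in the free factor, which has no torsion. -/
theorem eq_one_of_colourSign_of_killColours (cs : CoxeterSystem m Γ) (hm : m.IsRightAngled)
    (c : V → W) (hc : ∀ v v', m v v' = 2 → c v ≠ c v') (w : W) {g : Γ} (hg : IsOfFinOrder g)
    (hs : cs.colourSign hm c w g = 1) (hk : cs.killColours hm c {w} g = 1) : g = 1 := by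
  have hlift : m.IsLiftable fun v => if c v = w then
      (⟨FreeGroup.of (cs.simple v), (-1, 1)⟩ :
        FreeGroup Γ ⋊[FreeGroup.signConjGenerators Γ] (ℤˣ × Γ))
      else ⟨1, (1, cs.simple v)⟩ := by
    apply hm.isLiftable
    -- For colour `w`, the sign turns the generator attached to `s_v` into the inverse of the one
    -- attached to `s_v⁻¹ = s_v`, so the square cancels.
    · intro v
      split_ifs <;> ext <;> simp
    · intro v v' h
      have h1 := hc v v' h
      have h2 := (cs.commute_simple h).eq
      have h3 : cs.simple v * cs.simple v' * cs.simple v = cs.simple v' := by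
        rw [h2, mul_assoc, cs.simple_mul_simple_self, mul_one]
      have h4 : cs.simple v' * cs.simple v * cs.simple v' = cs.simple v := by
        rw [← h2, mul_assoc, cs.simple_mul_simple_self, mul_one]
      split_ifs with h5 h6 h6
      -- Two distinct free generators would not commute here; the colouring excludes this case.
      · exact absurd (h5.trans h6.symm) h1
      · apply SemidirectProduct.ext <;> simp [h4]
      · apply SemidirectProduct.ext <;> simp [h3]
      · apply SemidirectProduct.ext <;> simp [h2]
  have hl : ∀ v, cs.lift ⟨_, hlift⟩ (cs.simple v) = _ := cs.lift_apply_simple hlift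
  set Φ := cs.lift ⟨_, hlift⟩ with hΦ
  have hinv : ((FreeGroup.evalSignConj Γ).comp Φ) = MonoidHom.id Γ := by
    apply cs.ext_simple
    intro v
    rw [MonoidHom.comp_apply, hl]
    split_ifs <;> simp [FreeGroup.evalSignConj, SemidirectProduct.lift]
  have hright : SemidirectProduct.rightHom.comp Φ =
      (cs.colourSign hm c w).prod (cs.killColours hm c {w}) := by
    apply cs.ext_simple
    intro v
    rw [MonoidHom.comp_apply, hl]
    split_ifs with h <;> simp [h]
  have h1 : (Φ g).right = 1 := by
    have h := DFunLike.congr_fun hright g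
    rwa [MonoidHom.prod_apply, hs, hk] at h
  have h2 : SemidirectProduct.inl (Φ g).left = Φ g := by
    apply SemidirectProduct.ext <;> simp [h1]
  have h3 : IsOfFinOrder (Φ g).left := by
    have h := MonoidHom.isOfFinOrder Φ hg
    rwa [← h2, SemidirectProduct.inl_injective.isOfFinOrder_iff] at h
  rw [isOfFinOrder_iff_eq_one] at h3
  rw [h3, map_one] at h2
  have h4 := DFunLike.congr_fun hinv g
  rwa [MonoidHom.comp_apply, ← h2, map_one, MonoidHom.id_apply, eq_comm] at h4

theorem eq_one_of_forall_colourSign [Fintype W] (cs : CoxeterSystem m Γ) (hm : m.IsRightAngled)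
    (c : V → W) (hc : ∀ v v', m v v' = 2 → c v ≠ c v') {g : Γ} (hg : IsOfFinOrder g)
    (hs : ∀ w, cs.colourSign hm c w g = 1) : g = 1 := by
  have hempty : cs.killColours hm c ∅ = MonoidHom.id Γ := cs.ext_simple fun v => by simp
  have huniv : cs.killColours hm c Finset.univ = 1 := cs.ext_simple fun v => by simp
  -- `S` is the set of surviving colours: nothing survives for `∅`, and the retraction is the
  -- identity for the full set.
  suffices h : ∀ S : Finset W, cs.killColours hm c Sᶜ g = 1 by
    have := h Finset.univ
    rwa [Finset.compl_univ, hempty] at this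
  intro S
  induction S using Finset.induction_on with
  | empty => rw [Finset.compl_empty, huniv, MonoidHom.one_apply]
  | insert w S hw ih =>
    apply cs.eq_one_of_colourSign_of_killColours hm c hc w
    · exact MonoidHom.isOfFinOrder _ hg
    · have : (cs.colourSign hm c w).comp (cs.killColours hm c (insert w S)ᶜ) =
          cs.colourSign hm c w := cs.ext_simple fun v => by
        simp only [MonoidHom.comp_apply, killColours_simple]
        by_cases h : c v = w
        · simp [h]
        · split_ifs <;> simp [h]
      rw [← hs w]
      exact DFunLike.congr_fun this g
    · have : (cs.killColours hm c {w}).comp (cs.killColours hm c (insert w S)ᶜ) =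
          cs.killColours hm c Sᶜ := cs.ext_simple fun v => by
        simp only [MonoidHom.comp_apply, killColours_simple]
        by_cases h : c v = w
        · simp [h, hw]
        · by_cases h' : c v ∈ S <;> simp [h, h']
      rw [← ih]
      exact DFunLike.congr_fun this g

theorem finite_closure_pair_iff [DecidableEq V] (cs : CoxeterSystem m Γ) (hm : m.IsRightAngled)
    {v w : V} (hne : v ≠ w) :
    (Subgroup.closure (cs.simple '' (({v, w} : Finset V) : Set V)) : Set Γ).Finite ↔
      m v w = 2 := by
  constructor
  · intro hfin
    rcases hm v w with h | h | h
    · exact absurd h (m.off_diagonal v w hne)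
    · exact h
    · exfalso
      -- `DihedralGroup 0` is the infinite dihedral group; two adjacent reflections have a product
      -- of infinite order.
      have hlift : m.IsLiftable fun u => if u = v then (DihedralGroup.sr 0 : DihedralGroup 0)
          else if u = w then DihedralGroup.sr 1 else 1 := by
        apply hm.isLiftable
        · intro u
          split_ifs <;> simp
        · intro u u' hu
          split_ifs <;> subst_vars <;> simp_all [m.symmetric]
      have hl := cs.lift_apply_simple hlift
      set Φ := cs.lift ⟨_, hlift⟩
      have hord : IsOfFinOrder (cs.simple v * cs.simple w) := by
        have : Finite (Subgroup.closure (cs.simple '' (({v, w} : Finset V) : Set V))) := hfin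
        have hmem : cs.simple v * cs.simple w ∈
            Subgroup.closure (cs.simple '' (({v, w} : Finset V) : Set V)) :=
          mul_mem (Subgroup.subset_closure ⟨v, by simp, rfl⟩)
            (Subgroup.subset_closure ⟨w, by simp, rfl⟩)
        exact (Subgroup.subtype_injective _).isOfFinOrder_iff.mpr (isOfFinOrder_of_finite
          (⟨_, hmem⟩ : Subgroup.closure (cs.simple '' (({v, w} : Finset V) : Set V))))
      have h1 := MonoidHom.isOfFinOrder Φ hord
      rw [map_mul, hl, hl] at h1
      simp only [if_true, hne.symm, if_false, DihedralGroup.sr_mul_sr, sub_zero] at h1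
      exact (orderOf_eq_zero_iff.mp DihedralGroup.orderOf_r_one) h1
  · intro h
    have hcomm := cs.commute_simple h
    rw [Finset.coe_pair, Set.image_pair]
    refine Set.Finite.subset (s := {1, cs.simple v, cs.simple w, cs.simple v * cs.simple w})
      (by simp) ?_
    intro x hx
    have h1 : cs.simple w * cs.simple v = cs.simple v * cs.simple w := hcomm.eq.symm
    have h2 : ∀ g, cs.simple w * (cs.simple v * g) = cs.simple v * (cs.simple w * g) := by
      intro g; rw [← mul_assoc, h1, mul_assoc]
    induction hx using Subgroup.closure_induction'' with
    | one => simp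
    | mem x hx => rcases hx with rfl | rfl <;> simp
    | inv_mem x hx => rcases hx with rfl | rfl <;> simp
    | mul x y _ _ hx hy =>
      rcases hx with rfl | rfl | rfl | rfl <;> rcases hy with rfl | rfl | rfl | rfl <;>
        simp [mul_assoc, h1, h2]

theorem oneSkeleton_adj_iff [DecidableEq V] (cs : CoxeterSystem m Γ) (hm : m.IsRightAngled)
    {v w : V} : cs.complexK.oneSkeleton.Adj v w ↔ m v w = 2 := by
  constructor
  · rintro ⟨hne, -, hfin⟩
    exact (cs.finite_closure_pair_iff hm hne).mp hfin
  · intro h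
    have hne : v ≠ w := by
      rintro rfl
      simp at h
    exact ⟨hne, Finset.insert_nonempty _ _, (cs.finite_closure_pair_iff hm hne).mpr h⟩

end CoxeterSystem
-- Central squares in the presented group.
section Presentation

variable {V W : Type*} {X : SimpleGraph V} {c : X.Coloring W} {d : X.edgeSet → X.Dart} {b : W → V}

theorem PresentedGroup.commute_of_adj_of_colouredRelators
    (hd : ∀ e, (d e).edge = (e : Sym2 V)) {v v' : V} (h : X.Adj v v') :
    Commute (PresentedGroup.of v : PresentedGroup (colouredRelators c d b))
      (PresentedGroup.of v') := by
  have h1 : ∀ e : X.edgeSet,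
      Commute (PresentedGroup.of (d e).fst : PresentedGroup (colouredRelators c d b))
        (PresentedGroup.of (d e).snd) := by
    intro e
    have h2 := PresentedGroup.one_of_mem (rels := colouredRelators c d b) (Or.inl ⟨e, rfl⟩)
    rw [map_mul, map_mul, map_mul, map_inv, map_inv, mul_inv_eq_one, mul_inv_eq_iff_eq_mul] at h2
    exact h2
  have h2 := hd ⟨s(v, v'), h⟩
  have h3 := h1 ⟨s(v, v'), h⟩
  generalize d ⟨s(v, v'), h⟩ = e at h2 h3
  have h4 : s(e.fst, e.snd) = s(v, v') := h2
  rcases Sym2.eq_iff.mp h4 with ⟨h5, h6⟩ | ⟨h5, h6⟩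
  · rwa [h5, h6] at h3
  · rw [h5, h6] at h3
    exact h3.symm

theorem PresentedGroup.of_sq_of_colouredRelators (v : V) :
    (PresentedGroup.of v : PresentedGroup (colouredRelators c d b)) ^ 2 =
      PresentedGroup.of (b (c v)) ^ 2 := by
  by_cases hv : v = b (c v)
  · rw [← hv]
  · have h := PresentedGroup.one_of_mem (rels := colouredRelators c d b)
      (Or.inr ⟨c v, v, rfl, hv, rfl⟩)
    rwa [map_mul, map_inv, map_pow, map_pow, mul_inv_eq_one] at h

theorem PresentedGroup.of_sq_mem_center_of_colouredRelators
    (hd : ∀ e, (d e).edge = (e : Sym2 V)) (hc : ∀ v w, ∃ u, c u = w ∧ (u = v ∨ X.Adj v u))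
    (w : W) :
    (PresentedGroup.of (b w) : PresentedGroup (colouredRelators c d b)) ^ 2 ∈
      Subgroup.center (PresentedGroup (colouredRelators c d b)) := by
  rw [Subgroup.mem_center_iff]
  intro g
  rw [← Subgroup.mem_centralizer_singleton_iff]
  refine PresentedGroup.generated_by _ _ (fun v => ?_) g
  rw [Subgroup.mem_centralizer_singleton_iff]
  obtain ⟨u, rfl, hu⟩ := hc v w
  -- The square of the base vertex may be replaced by that of `u`, which equals `v` or is adjacent
  -- to it.
  rw [← PresentedGroup.of_sq_of_colouredRelators u]
  rcases hu with rfl | hu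
  · exact ((Commute.refl _).pow_right 2).eq
  · exact ((PresentedGroup.commute_of_adj_of_colouredRelators hd hu).pow_right 2).eq

end Presentation

/-- The homomorphism from a finitely generated free abelian group that sends the basis element
of index `w` to `t w`. -/
def MonoidHom.piZPowers {W H : Type*} [Fintype W] [CommGroup H] (t : W → H) :
    Multiplicative (W → ℤ) →* H where
  toFun z := ∏ w, t w ^ (z.toAdd w)
  map_one' := by simp
  map_mul' z z' := by simp [zpow_add, Finset.prod_mul_distrib]

/-! ### The parity subgroup: torsion-freeness and presentation. -/

namespace CoxeterSystem

variable {V Γ W : Type*} [Group Γ] [DecidableEq W] {m : CoxeterMatrix V}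

/-- The sum of the colour parities of the two components, with values in signs. -/
def colourParity (cs : CoxeterSystem m Γ) (hm : m.IsRightAngled) (c : V → W) :
    Γ × Multiplicative (W → ℤ) →* (W → ℤˣ) where
  toFun p w := cs.colourSign hm c w p.1 * (-1) ^ (p.2.toAdd w)
  map_one' := by ext; simp
  map_mul' p q := by
    funext w
    simp [zpow_add, mul_mul_mul_comm]

@[simp]
theorem colourParity_apply (cs : CoxeterSystem m Γ) (hm : m.IsRightAngled) (c : V → W)
    (p : Γ × Multiplicative (W → ℤ)) (w : W) :
    cs.colourParity hm c p w = cs.colourSign hm c w p.1 * (-1) ^ (p.2.toAdd w) := rfl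

theorem groupTorsionFree_ker_colourParity [Fintype W] (cs : CoxeterSystem m Γ)
    (hm : m.IsRightAngled) (c : V → W) (hc : ∀ v v', m v v' = 2 → c v ≠ c v') :
    GroupTorsionFree (cs.colourParity hm c).ker := by
  rintro ⟨⟨g, z⟩, hp⟩ hfin
  have h1 : IsOfFinOrder (g, z) := (Subgroup.subtype_injective _).isOfFinOrder_iff.mpr hfin
  have hz : z = 1 := by
    obtain ⟨k, hk, hk'⟩ := isOfFinOrder_iff_pow_eq_one.mp h1
    have h2 : z ^ k = 1 := congrArg Prod.snd hk'
    have h3 : k • z.toAdd = 0 := h2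
    exact (smul_eq_zero.mp h3).resolve_left hk.ne'
  subst hz
  have hg : g = 1 := by
    refine cs.eq_one_of_forall_colourSign hm c hc (MonoidHom.isOfFinOrder (MonoidHom.fst _ _) h1)
      fun w => ?_
    simpa using congrFun ((MonoidHom.mem_ker).mp hp) w
  subst hg
  rfl

open scoped IsMulCommutative in
theorem presentedGroup_mulEquiv_ker_colourParity [Fintype W] {X : SimpleGraph V}
    (cs : CoxeterSystem m Γ) (hm : m.IsRightAngled) (hX : ∀ {v w}, X.Adj v w ↔ m v w = 2)
    (c : X.Coloring W) (hc : ∀ v w, ∃ u, c u = w ∧ (u = v ∨ X.Adj v u))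
    (d : X.edgeSet → X.Dart) (hd : ∀ e, (d e).edge = (e : Sym2 V))
    (b : W → V) (hb : ∀ w, c (b w) = w) :
    Nonempty (PresentedGroup (colouredRelators c d b) ≃* (cs.colourParity hm c).ker) := by
  let f : V → Γ × Multiplicative (W → ℤ) := fun v =>
    (cs.simple v, Multiplicative.ofAdd (Pi.single (c v) 1))
  have hf : ∀ r ∈ colouredRelators c d b, FreeGroup.lift f r = 1 := by
    rintro r (⟨e, rfl⟩ | ⟨w, v, rfl, -, rfl⟩)
    · have h := cs.commute_simple (hX.mp (d e).adj)
      have h1 : Commute (f (d e).fst) (f (d e).snd) := Prod.ext h.eq (mul_comm _ _)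
      simp [h1.eq]
    · simp only [map_mul, map_inv, map_pow, FreeGroup.lift_apply_of, mul_inv_eq_one]
      apply Prod.ext <;> simp [f, hb]
  let F := PresentedGroup.toGroup hf
  have hF : ∀ v, F (PresentedGroup.of v) = f v := fun v => PresentedGroup.toGroup.of hf
  have hF_ker : ∀ g, cs.colourParity hm c (F g) = 1 := by
    have : (cs.colourParity hm c).comp F = 1 := by
      apply PresentedGroup.ext
      intro v
      funext w
      rw [MonoidHom.comp_apply, hF]
      by_cases h : c v = w
      · subst h
        simp [f]
      · simp [f, h, Ne.symm h]
    exact DFunLike.congr_fun this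
  let G := PresentedGroup (colouredRelators c d b)
  let t : W → Subgroup.center G := fun w =>
    ⟨PresentedGroup.of (b w) ^ 2, PresentedGroup.of_sq_mem_center_of_colouredRelators hd hc w⟩
  -- `τ` parametrizes the subgroup generated by the central squares; composed with `F` it is `z ↦
  -- (1, 2z)` in additive notation, hence injective.
  let τ : Multiplicative (W → ℤ) →* Subgroup.center G := MonoidHom.piZPowers t
  have ht : ∀ w, F (t w) = f (b w) ^ 2 := fun w => (map_pow F _ 2).trans (by rw [hF])
  have hτ_fst : ∀ z, (F (τ z)).1 = 1 := by
    intro z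
    change τ z ∈ (((MonoidHom.fst _ _).comp F).comp (Subgroup.center G).subtype).ker
    refine Subgroup.prod_mem _ fun w _ => Subgroup.zpow_mem _ ?_ _
    rw [MonoidHom.mem_ker]
    simp [ht, f]
  have hτ_snd : ∀ z, (F (τ z)).2 = z ^ 2 := by
    intro z
    change (((MonoidHom.snd _ _).comp F).comp (Subgroup.center G).subtype) (τ z) = _
    simp only [τ, MonoidHom.piZPowers, MonoidHom.coe_mk, OneHom.coe_mk, map_prod, map_zpow]
    simp only [MonoidHom.comp_apply, Subgroup.subtype_apply, ht]
    apply Multiplicative.toAdd.injective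
    funext w
    simp [f, hb, toAdd_prod, Pi.single_apply, mul_comm]
  have hinj : Function.Injective F := by
    let N : Subgroup G := τ.range.map (Subgroup.center G).subtype
    have hN : N.Normal := ⟨by
      rintro _ ⟨t, ht, rfl⟩ g
      have : g * (t : G) * g⁻¹ = t := by
        rw [Subgroup.mem_center_iff.mp t.2 g, mul_inv_cancel_right]
      rw [Subgroup.subtype_apply, this]
      exact ⟨t, ht, rfl⟩⟩
    have hmem : ∀ w, (PresentedGroup.of (b w) : G) ^ 2 ∈ N := by
      intro w
      refine ⟨_, ⟨Multiplicative.ofAdd (Pi.single w 1), rfl⟩, ?_⟩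
      simp only [τ, MonoidHom.piZPowers, MonoidHom.coe_mk, OneHom.coe_mk, toAdd_ofAdd]
      rw [Finset.prod_eq_single w (fun w' _ h => by simp [h]) (by simp)]
      simp [t]
    have hlift : m.IsLiftable fun v => QuotientGroup.mk' N (PresentedGroup.of v) := by
      apply hm.isLiftable
      · intro v
        rw [← map_mul, ← pow_two, PresentedGroup.of_sq_of_colouredRelators v]
        exact (QuotientGroup.eq_one_iff _).mpr (hmem _)
      · intro v w h
        exact (PresentedGroup.commute_of_adj_of_colouredRelators hd (hX.mpr h)).map _
    -- The quotient map by `N` factors through the first component of `F`, so the kernel of `F` lies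
    -- in `N`, where `F` is already known to be injective.
    have hs : (cs.lift ⟨_, hlift⟩).comp ((MonoidHom.fst _ _).comp F) = QuotientGroup.mk' N := by
      apply PresentedGroup.ext
      intro v
      rw [MonoidHom.comp_apply, MonoidHom.comp_apply, hF]
      exact cs.lift_apply_simple hlift v
    rw [injective_iff_map_eq_one]
    intro g hg
    have h1 := DFunLike.congr_fun hs g
    rw [MonoidHom.comp_apply, MonoidHom.comp_apply, hg, map_one, map_one] at h1
    obtain ⟨_, ⟨z, rfl⟩, rfl⟩ := (QuotientGroup.eq_one_iff _).mp h1.symm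
    have h2 := hτ_snd z
    rw [Subgroup.subtype_apply] at hg
    rw [hg] at h2
    have h3 : (2 : ℕ) • z.toAdd = 0 := h2.symm
    have h4 : z = 1 := (smul_eq_zero.mp h3).resolve_left two_ne_zero
    rw [h4, map_one, map_one]
  have hfst : ∀ g, ∃ h, (F h).1 = g := by
    intro g
    induction g using cs.simple_induction with
    | simple v => exact ⟨PresentedGroup.of v, by rw [hF]⟩
    | one => exact ⟨1, by rw [map_one]; rfl⟩
    | mul g g' hg hg' =>
      obtain ⟨h, rfl⟩ := hg
      obtain ⟨h', rfl⟩ := hg'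
      exact ⟨h * h', by rw [map_mul]; rfl⟩
  have hrange : F.range = (cs.colourParity hm c).ker := by
    apply le_antisymm
    · rintro _ ⟨g, rfl⟩
      exact hF_ker g
    · rintro ⟨g, z⟩ hp
      obtain ⟨h, rfl⟩ := hfst g
      -- Two elements of the kernel with the same first component differ by an even vector, which
      -- `τ` supplies.
      have hpar : ∀ w, ∃ y : ℤ, z.toAdd w = (F h).2.toAdd w + 2 * y := by
        intro w
        have h1 := congrFun (hp.trans (hF_ker h).symm) w
        rw [colourParity_apply, colourParity_apply] at h1
        obtain ⟨y, hy⟩ := (Int.negOnePow_eq_iff _ _).mp (mul_left_cancel h1)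
        exact ⟨y, by linarith⟩
      choose y hy using hpar
      refine ⟨h * τ (Multiplicative.ofAdd y), ?_⟩
      rw [map_mul]
      apply Prod.ext
      · simp [hτ_fst]
      · rw [Prod.snd_mul, hτ_snd]
        apply Multiplicative.toAdd.injective
        funext w
        simp [hy]
  exact ⟨(MonoidHom.ofInjective hinj).trans (MulEquiv.subgroupCongr hrange)⟩

end CoxeterSystem
-- Lengths and number of the relators.
namespace FreeGroup

theorem IsReduced.norm_mk {α : Type*} [DecidableEq α] {L : List (α × Bool)}
    (h : IsReduced L) : norm (mk L) = L.length := by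
  rw [norm, toWord_mk, h.reduce_eq]

theorem IsReduced.eq_of_mk_eq {α : Type*} [DecidableEq α] {L L' : List (α × Bool)}
    (h : IsReduced L) (h' : IsReduced L') (he : mk L = mk L') : L = L' := by
  rw [← h.reduce_eq, ← h'.reduce_eq, ← toWord_mk, ← toWord_mk, he]

theorem isReduced_commutator {α : Type*} {x y : α} (h : x ≠ y) :
    IsReduced [(x, true), (y, true), (x, false), (y, false)] := by
  simp [IsReduced, h, h.symm]

theorem isReduced_sq_mul_inv_sq {α : Type*} {x y : α} (h : x ≠ y) :
    IsReduced [(x, true), (x, true), (y, false), (y, false)] := by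
  simp [IsReduced, h]

theorem commutator_eq_mk {α : Type*} (x y : α) :
    of x * of y * (of x)⁻¹ * (of y)⁻¹ = mk [(x, true), (y, true), (x, false), (y, false)] := rfl

theorem sq_mul_inv_sq_eq_mk {α : Type*} (x y : α) :
    of x ^ 2 * (of y ^ 2)⁻¹ = mk [(x, true), (x, true), (y, false), (y, false)] := by
  rw [pow_two, pow_two]
  rfl

end FreeGroup

section Relators

variable {V W : Type*} [DecidableEq V] {X : SimpleGraph V} {c : X.Coloring W}
  {d : X.edgeSet → X.Dart} {b : W → V}

theorem norm_of_mem_colouredRelators {r : FreeGroup V} (hr : r ∈ colouredRelators c d b) :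
    FreeGroup.norm r = 4 := by
  rcases hr with ⟨e, rfl⟩ | ⟨w, v, -, hv, rfl⟩
  · rw [FreeGroup.commutator_eq_mk, (FreeGroup.isReduced_commutator (d e).adj.ne).norm_mk]
    rfl
  · rw [FreeGroup.sq_mul_inv_sq_eq_mk, (FreeGroup.isReduced_sq_mul_inv_sq hv).norm_mk]
    rfl

/-- The relators are reduced words, so their letters recover the edge or the vertex and no two
coincide. The vertices without a square relator are exactly the base vertices, one per colour;
adding their number back avoids cardinal subtraction. -/
theorem mk_colouredRelators_add_card [Fintype W] (hd : ∀ e, (d e).edge = (e : Sym2 V))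
    (hb : ∀ w, c (b w) = w) :
    Cardinal.mk (colouredRelators c d b) + (Fintype.card W : Cardinal) =
      Cardinal.mk X.edgeSet + Cardinal.mk V := by
  let f : X.edgeSet → FreeGroup V := fun e => FreeGroup.of (d e).fst * FreeGroup.of (d e).snd *
    (FreeGroup.of (d e).fst)⁻¹ * (FreeGroup.of (d e).snd)⁻¹
  let S : Set V := {v | v ≠ b (c v)}
  let f' : S → FreeGroup V := fun v => FreeGroup.of v.1 ^ 2 * (FreeGroup.of (b (c v.1)) ^ 2)⁻¹
  have hunion : colouredRelators c d b = Set.range f ∪ Set.range f' := by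
    ext r
    constructor
    · rintro (⟨e, rfl⟩ | ⟨w, v, rfl, hv, rfl⟩)
      · exact Or.inl ⟨e, rfl⟩
      · exact Or.inr ⟨⟨v, hv⟩, rfl⟩
    · rintro (⟨e, rfl⟩ | ⟨⟨v, hv⟩, rfl⟩)
      · exact Or.inl ⟨e, rfl⟩
      · exact Or.inr ⟨c v, v, rfl, hv, rfl⟩
  have hf : Function.Injective f := by
    intro e e' h
    have h1 := (FreeGroup.isReduced_commutator (d e).adj.ne).eq_of_mk_eq
      (FreeGroup.isReduced_commutator (d e').adj.ne) h
    simp only [List.cons.injEq, Prod.mk.injEq] at h1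
    apply Subtype.ext
    rw [← hd e, ← hd e', SimpleGraph.Dart.ext_iff _ _ |>.mpr (Prod.ext h1.1.1 h1.2.1.1)]
  have hf' : Function.Injective f' := by
    rintro ⟨v, hv⟩ ⟨v', hv'⟩ h
    simp only [f', FreeGroup.sq_mul_inv_sq_eq_mk] at h
    have h1 := (FreeGroup.isReduced_sq_mul_inv_sq hv).eq_of_mk_eq
      (FreeGroup.isReduced_sq_mul_inv_sq hv') h
    simp only [List.cons.injEq, Prod.mk.injEq] at h1
    exact Subtype.ext h1.1.1
  have hdisj : Disjoint (Set.range f) (Set.range f') := by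
    rw [Set.disjoint_left]
    rintro _ ⟨e, rfl⟩ ⟨⟨v, hv⟩, h⟩
    simp only [f, f', FreeGroup.sq_mul_inv_sq_eq_mk, FreeGroup.commutator_eq_mk] at h
    have h1 := (FreeGroup.isReduced_sq_mul_inv_sq hv).eq_of_mk_eq
      (FreeGroup.isReduced_commutator (d e).adj.ne) h
    simp only [List.cons.injEq, Prod.mk.injEq] at h1
    exact (d e).adj.ne (h1.1.1.symm.trans h1.2.1.1)
  have hS : Cardinal.mk (Sᶜ : Set V) = (Fintype.card W : Cardinal) := by
    have h : Sᶜ = Set.range b := by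
      ext v
      constructor
      · intro hv
        exact ⟨c v, (not_not.mp hv).symm⟩
      · rintro ⟨w, rfl⟩ h
        exact h (by rw [hb])
    rw [h]
    have hbi : Function.Injective b := fun w w' h => by rw [← hb w, h, hb w']
    have := Cardinal.mk_range_eq_of_injective hbi
    simpa using this
  rw [hunion, Cardinal.mk_union_of_disjoint hdisj, Cardinal.mk_range_eq f hf,
    Cardinal.mk_range_eq f' hf', add_assoc, ← hS, Cardinal.mk_sum_compl]

end Relators

theorem CoxeterSystem.exists_colour_eq_adj_of_starVertices {V Γ W : Type*} [DecidableEq V]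
    [Group Γ] {m : CoxeterMatrix V} (cs : CoxeterSystem m Γ) {v : V} {c : V → W} {w : W}
    (h : ∃ u ∈ cs.complexK.starVertices v, c u = w) :
    ∃ u, c u = w ∧ (u = v ∨ cs.complexK.oneSkeleton.Adj v u) := by
  obtain ⟨u, ⟨σ, hσ, hv, hu⟩, rfl⟩ := h
  refine ⟨u, rfl, or_iff_not_imp_left.mpr fun hne => ⟨Ne.symm hne, ?_⟩⟩
  -- Two distinct vertices of a common simplex span an edge, as faces are closed under nonempty
  -- subsets.
  refine (cs.complexK.isRelLowerSet_faces hσ).2 ?_ (Finset.insert_nonempty _ _)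
  intro x hx
  rcases Finset.mem_insert.mp hx with rfl | hx
  · exact hv
  · rwa [Finset.mem_singleton.mp hx]

theorem proposition13 {V : Type*} [DecidableEq V] [Nonempty V] {Γ : Type*} [Group Γ]
    {m : CoxeterMatrix V} (cs : CoxeterSystem m Γ) (hm : m.IsRightAngled)
    (n : ℕ) (c : cs.complexK.oneSkeleton.Coloring (Fin (n + 1)))
    (hc : ∀ (v : V) (w : Fin (n + 1)), ∃ u ∈ cs.complexK.starVertices v, c u = w) :
    ∃ P : Subgroup (Γ × Multiplicative (Fin (n + 1) → ℤ)),
      GroupTorsionFree P ∧ P.FiniteIndex ∧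
      ∀ (d : cs.complexK.oneSkeleton.edgeSet → cs.complexK.oneSkeleton.Dart)
        (_ : ∀ e, (d e).edge = (e : Sym2 V))
        (b : Fin (n + 1) → V) (_ : ∀ w, c (b w) = w),
        Nonempty (PresentedGroup (colouredRelators c d b) ≃* P) ∧
        Cardinal.mk (colouredRelators c d b) + ((n + 1 : ℕ) : Cardinal) =
          Cardinal.mk cs.complexK.oneSkeleton.edgeSet + Cardinal.mk V ∧
        ∀ r ∈ colouredRelators c d b, FreeGroup.norm r = 4 := by
  have hX : ∀ {v w : V}, cs.complexK.oneSkeleton.Adj v w ↔ m v w = 2 :=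
    cs.oneSkeleton_adj_iff hm
  refine ⟨(cs.colourParity hm c).ker,
    cs.groupTorsionFree_ker_colourParity hm c fun v v' h => c.valid (hX.mpr h),
    inferInstance, fun d hd b hb => ⟨?_, ?_, fun r hr => norm_of_mem_colouredRelators hr⟩⟩
  · exact cs.presentedGroup_mulEquiv_ker_colourParity hm hX c
      (fun v w => cs.exists_colour_eq_adj_of_starVertices (hc v w)) d hd b hb
  · simpa using mk_colouredRelators_add_card hd hb
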